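/- Let $k$ be a field of characteristic $0$ and let $\alpha,\beta\in k$ with $\beta\neq 0$. Let $$A=A(\alpha,\beta)=k\langle x,y\rangle/(x^2y-\alpha xyx-\beta yx^2,\ xy^2-\alpha yxy-\beta y^2x)$$ be the corresponding (graded, noetherian) down-up algebra, and suppose that $A$ is PI, i.e. that some nonzero noncommutative polynomial with coefficients in $k$ vanishes identically on $A$. Let $\mathrm{Oz}(A)$ be the ozone group of $A$, that is, the group of all $k$-algebra automorphisms of $A$ that fix the center of $A$ pointwise. Then $\phi(x)\in kx$ and $\phi(y)\in ky$ for every $\phi\in\mathrm{Oz}(A)$. Consequently, $\mathrm{Oz}(A)$ is abelian. -/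

import Mathlib

/-- A `k`-algebra `A` is PI if it satisfies a polynomial identity: some nonzero noncommutative
polynomial `f` with coefficients in `k` vanishes under every substitution of its variables by
elements of `A`. -/
def IsPIAlgebra (k A : Type*) [CommRing k] [Ring A] [Algebra k A] : Prop :=
  ∃ f : FreeAlgebra k ℕ, f ≠ 0 ∧ ∀ v : ℕ → A, FreeAlgebra.lift k v f = 0

/-- The Galois group of `A` over a subalgebra `C` (of the center): the group of all `k`-algebra
automorphisms of `A` that fix `C` pointwise. -/
def galoisGroupOver {k A : Type*} [CommRing k] [Ring A] [Algebra k A] (C : Subalgebra k A) :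
    Subgroup (A ≃ₐ[k] A) where
  carrier := {σ | ∀ c ∈ C, σ c = c}
  one_mem' := fun _ _ => rfl
  mul_mem' := fun {σ τ} hσ hτ c hc => by
    rw [AlgEquiv.mul_apply, hτ c hc, hσ c hc]
  inv_mem' := fun {σ} hσ c hc => by
    change σ.symm c = c
    rw [AlgEquiv.symm_apply_eq, hσ c hc]

/-- The ozone group `Oz(A)`: the `k`-algebra automorphisms of `A` fixing its center pointwise. -/
def ozoneGroup (k A : Type*) [CommRing k] [Ring A] [Algebra k A] : Subgroup (A ≃ₐ[k] A) :=
  galoisGroupOver (Subalgebra.center k A)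

namespace DownUpAlgebra

/-- The free generator `x` of `k⟨x, y⟩`. -/
abbrev X (k : Type*) [CommRing k] : FreeAlgebra k (Fin 2) := FreeAlgebra.ι k 0

/-- The free generator `y` of `k⟨x, y⟩`. -/
abbrev Y (k : Type*) [CommRing k] : FreeAlgebra k (Fin 2) := FreeAlgebra.ι k 1

/-- The two defining relations of the graded down-up algebra:
`x²y - α xyx - β yx² = 0` and `xy² - α yxy - β y²x = 0`. -/
inductive Rel {k : Type*} [CommRing k] (α β : k) :
    FreeAlgebra k (Fin 2) → FreeAlgebra k (Fin 2) → Prop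
  | xxy : Rel α β (X k ^ 2 * Y k - α • (X k * Y k * X k) - β • (Y k * X k ^ 2)) 0
  | xyy : Rel α β (X k * Y k ^ 2 - α • (Y k * X k * Y k) - β • (Y k ^ 2 * X k)) 0

end DownUpAlgebra

/-- The graded down-up algebra `A(α, β)`, i.e. the quotient of `k⟨x, y⟩` by the two-sided ideal
generated by `x²y - α xyx - β yx²` and `xy² - α yxy - β y²x`. -/
def DownUpAlgebra {k : Type*} [CommRing k] (α β : k) : Type _ :=
  RingQuot (DownUpAlgebra.Rel α β)

namespace DownUpAlgebra

variable {k : Type*} [CommRing k] (α β : k)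

instance : Ring (DownUpAlgebra α β) := inferInstanceAs (Ring (RingQuot (Rel α β)))

instance : Algebra k (DownUpAlgebra α β) := inferInstanceAs (Algebra k (RingQuot (Rel α β)))

/-- The generator `x` of `A(α, β)`. -/
def x : DownUpAlgebra α β := RingQuot.mkAlgHom k (Rel α β) (X k)

/-- The generator `y` of `A(α, β)`. -/
def y : DownUpAlgebra α β := RingQuot.mkAlgHom k (Rel α β) (Y k)

end DownUpAlgebra

/-! Put `u = xy`, `v = yx`. These commute, and the defining relations say that moving `x` or `y`
past `k[u, v]` applies the automorphism `σ : u ↦ αu + βv, v ↦ u`, or its inverse. So `A` is realized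
in the skew Laurent ring over `k[u, v]`, with `y = x⁻¹u`.

If the `σ`-orbit of `u` were infinite, evaluating an identity at elements `rᵢx` would contradict
Dedekind's independence of characters (`exists_shift_pow_u_eq`). Hence `σ^(n+1) u = u` for some `n`,
which makes `x^(n+1)` and `y^(n+1)` central. An ozone automorphism `φ` then satisfies `φ(x)^(n+1) =
x^(n+1)`. Comparing highest and lowest terms shows that `φ(x) = px` with `p` a unit of `k[u, v]`,
hence a scalar; likewise for `y` (`exists_eq_smul_of_pow_eq`). Diagonal automorphisms commute. -/

namespace SkewMonoidAlgebra

/-! ### Leading terms and roots of monomials in skew group rings. -/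

section LeadingCoefficient

variable {R G M : Type*} [CommRing R] [Group G] [MulSemiringAction G R]
  [CommGroup M] [LinearOrder M] [IsOrderedMonoid M]

/-- The support of a product lies below the product of two upper bounds of the supports. -/
theorem le_of_coeff_mul_ne_zero (w : G →* M) {f g : SkewMonoidAlgebra R G} {s t : M}
    (hf : ∀ c, f.coeff c ≠ 0 → w c ≤ s) (hg : ∀ c, g.coeff c ≠ 0 → w c ≤ t)
    (c : G) (hc : (f * g).coeff c ≠ 0) : w c ≤ s * t := by
  classical
  obtain ⟨a, ha, b, hb, rfl⟩ := Finset.mem_mul.1 (support_mul f g (mem_support_iff.2 hc))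
  rw [map_mul]
  exact mul_le_mul' (hf a (mem_support_iff.1 ha)) (hg b (mem_support_iff.1 hb))

/-- The leading coefficient of a product with respect to an injective weight. -/
theorem coeff_mul_of_le (w : G →* M) (hw : Function.Injective w) {f g : SkewMonoidAlgebra R G}
    {a b : G} (hf : ∀ c, f.coeff c ≠ 0 → w c ≤ w a) (hg : ∀ c, g.coeff c ≠ 0 → w c ≤ w b) :
    (f * g).coeff (a * b) = f.coeff a * a • g.coeff b := by
  classical
  rw [coeff_mul_left, sum_def, Finsupp.sum, Finset.sum_eq_single a]
  · simp
  · intro c hc hca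
    have hlt : w c < w a := lt_of_le_of_ne (hf c (by simpa using hc)) (hw.ne hca)
    have : g.coeff (c⁻¹ * (a * b)) = 0 := by
      by_contra h
      have := hg _ h
      rw [map_mul, map_mul, map_inv, ← mul_assoc, mul_le_iff_le_one_left',
        inv_mul_le_one_iff] at this
      exact absurd this (not_le.2 hlt)
    rw [this, smul_zero, mul_zero]
  · intro ha
    have : f.coeff a = 0 := by simpa using ha
    rw [this, zero_mul]

/-- The leading coefficient of a power is a product of translates of the original one; group
elements act injectively and `R` is a domain, so nothing cancels. -/
theorem coeff_pow_ne_zero_of_le [IsDomain R] (w : G →* M) (hw : Function.Injective w)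
    {f : SkewMonoidAlgebra R G} {a : G} (ha : f.coeff a ≠ 0)
    (hf : ∀ c, f.coeff c ≠ 0 → w c ≤ w a) (n : ℕ) :
    (f ^ n).coeff (a ^ n) ≠ 0 ∧ ∀ c, (f ^ n).coeff c ≠ 0 → w c ≤ w (a ^ n) := by
  induction n with
  | zero =>
    refine ⟨by simp, fun c hc => ?_⟩
    rw [pow_zero, coeff_one, Finsupp.single_apply_ne_zero] at hc
    simp [hc.1]
  | succ n ih =>
    rw [pow_succ, pow_succ, coeff_mul_of_le w hw ih.2 hf]
    refine ⟨mul_ne_zero ih.1 ((smul_ne_zero_iff_ne _).2 ha), fun c hc => ?_⟩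
    rw [map_mul]
    exact le_of_coeff_mul_ne_zero w ih.2 hf c hc

/-- If a power of `f` is a monomial of weight `a ^ n`, then `f` has no term of weight above `a`. -/
theorem le_of_pow_eq_single [IsDomain R] (w : G →* M) (hw : Function.Injective w)
    {f : SkewMonoidAlgebra R G} {a : G} {r : R} {n : ℕ} (hn : n ≠ 0)
    (h : f ^ n = single (a ^ n) r) (c : G) (hc : f.coeff c ≠ 0) : w c ≤ w a := by
  obtain ⟨b, hb, hmax⟩ := f.support.exists_max_image w ⟨c, mem_support_iff.2 hc⟩
  have hb' := mem_support_iff.1 hb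
  have key := (coeff_pow_ne_zero_of_le w hw hb'
    (fun d hd => hmax d (mem_support_iff.2 hd)) n).1
  rw [h, coeff_single, Finsupp.single_apply_ne_zero] at key
  have hba : w b = w a := by
    have := congrArg w key.1
    rw [map_pow, map_pow] at this
    exact (pow_left_inj hn).1 this
  exact hba ▸ hmax c (mem_support_iff.2 hc)

end LeadingCoefficient

/-- Over a domain and a linearly ordered group, an `n`-th root of a monomial of degree `a ^ n` is a
monomial of degree `a`. -/
theorem eq_single_of_pow_eq_single {R G : Type*} [CommRing R] [IsDomain R] [CommGroup G]
    [LinearOrder G] [IsOrderedMonoid G] [MulSemiringAction G R]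
    {f : SkewMonoidAlgebra R G} {a : G} {r : R} {n : ℕ} (hn : n ≠ 0)
    (h : f ^ n = single (a ^ n) r) : f = single a (f.coeff a) := by
  classical
  ext c
  rw [coeff_single, Finsupp.single_apply]
  split_ifs with hac
  · rw [hac]
  · by_contra hc
    -- The identity weight bounds the degrees from above, the inverse weight from below.
    have h1 := le_of_pow_eq_single (MonoidHom.id G) Function.injective_id hn h c hc
    have h2 := le_of_pow_eq_single (invMonoidHom (α := G)) inv_injective hn h c hc
    exact hac (le_antisymm (inv_le_inv_iff.1 h2) h1)

end SkewMonoidAlgebra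

/-! ### Polynomial identities and independence of characters. -/

namespace SkewMonoidAlgebra

open Polynomial in
/-- The map `r ↦ ∏ j, g ^ j • r (w j)` determines the word `w`, provided the translates of some
element of the algebra `R` over an infinite field under the powers of `g` are distinct. -/
theorem eq_of_prod_pow_smul_eq {k R G : Type*} [Field k] [Infinite k] [CommRing R] [IsDomain R]
    [Algebra k R] [Group G] [MulSemiringAction G R] [SMulCommClass G k R] {g : G} {u : R}
    (hu : Function.Injective fun j : ℕ => g ^ j • u) {l : ℕ} {w w' : Fin l → ℕ}
    (h : ∀ r : ℕ → R, ∏ j : Fin l, g ^ (j : ℕ) • r (w j) = ∏ j : Fin l, g ^ (j : ℕ) • r (w' j)) :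
    w = w' := by
  classical
  funext j
  -- Substitute `t + u` for the letter `w j` and `1` for all others. As a polynomial in `t`, the
  -- product has roots `-(g ^ m • u)` exactly at the positions `m` carrying that letter, and these
  -- roots are distinct.
  let P : (Fin l → ℕ) → R[X] := fun v =>
    ∏ m : Fin l, if v m = w j then X + C (g ^ (m : ℕ) • u) else 1
  have hP : ∀ (v : Fin l → ℕ) (t : k), (P v).eval (algebraMap k R t) =
      ∏ m : Fin l, g ^ (m : ℕ) • (if v m = w j then algebraMap k R t + u else 1) := by
    intro v t
    rw [eval_prod]
    refine Finset.prod_congr rfl fun m _ => ?_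
    split_ifs
    · simp [smul_add, smul_algebraMap]
    · simp
  have hPP : P w = P w' := by
    refine eq_of_infinite_eval_eq _ _ ((Set.infinite_range_of_injective
      (algebraMap k R).injective).mono ?_)
    rintro _ ⟨t, rfl⟩
    change eval _ _ = eval _ _
    rw [hP, hP]
    exact h fun i => if i = w j then algebraMap k R t + u else 1
  have hroot : (P w).eval (-(g ^ (j : ℕ) • u)) = 0 := by
    rw [eval_prod]
    exact Finset.prod_eq_zero (Finset.mem_univ j) (by simp)
  rw [hPP, eval_prod, Finset.prod_eq_zero_iff] at hroot
  obtain ⟨m, -, hm⟩ := hroot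
  split_ifs at hm with hmj
  · rw [eval_add, eval_X, eval_C, neg_add_eq_zero] at hm
    rw [show j = m from Fin.ext (hu hm)] at hmj ⊢
    exact hmj.symm
  · simp at hm

/-- The coefficient at position `j` is moved left past `j` copies of `g`. -/
theorem list_prod_map_single {R G : Type*} [CommRing R] [Group G] [MulSemiringAction G R] (g : G)
    (r : ℕ → R) (w : List ℕ) :
    (w.map fun i => single g (r i)).prod =
      single (g ^ w.length) (∏ j : Fin w.length, g ^ (j : ℕ) • r (w.get j)) := by
  induction w with
  | nil => simp
  | cons a w ih =>
    rw [List.map_cons, List.prod_cons, ih, single_mul_single]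
    simp [Fin.prod_univ_succ, pow_succ', Finset.smul_prod', mul_smul]

theorem _root_.FreeAlgebra.lift_equivMonoidAlgebraFreeMonoid_symm {k A : Type*} [CommRing k]
    [Ring A] [Algebra k A] (z : ℕ → A) (F : MonoidAlgebra k (FreeMonoid ℕ)) :
    FreeAlgebra.lift k z (FreeAlgebra.equivMonoidAlgebraFreeMonoid.symm F) =
      F.coeff.sum fun w c => c • (w.toList.map z).prod := by
  have : (FreeAlgebra.lift k z).comp
      (FreeAlgebra.equivMonoidAlgebraFreeMonoid (R := k) (X := ℕ)).symm.toAlgHom =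
      MonoidAlgebra.lift k A (FreeMonoid ℕ) (FreeMonoid.lift z) := by
    apply MonoidAlgebra.algHom_ext'
    · refine FreeMonoid.hom_eq fun i => ?_
      simp [FreeAlgebra.equivMonoidAlgebraFreeMonoid]
    · ext
  have := DFunLike.congr_fun this F
  simpa [MonoidAlgebra.lift_apply, FreeMonoid.lift_apply] using this

/-- If the translates of some `u : R` under the powers of `g` are distinct, then no nonzero
noncommutative polynomial vanishes on all families of monomials of degree `g`. -/
theorem eq_zero_of_forall_lift_single_eq_zero {k R G : Type*} [Field k] [Infinite k] [CommRing R]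
    [IsDomain R] [Algebra k R] [Group G] [MulSemiringAction G R] [SMulCommClass G k R] {g : G}
    (hg : Function.Injective fun j : ℕ => g ^ j) {u : R}
    (hu : Function.Injective fun j : ℕ => g ^ j • u) (f : FreeAlgebra k ℕ)
    (hf : ∀ r : ℕ → R, FreeAlgebra.lift k (fun i => single g (r i)) f = 0) : f = 0 := by
  classical
  obtain ⟨F, rfl⟩ := FreeAlgebra.equivMonoidAlgebraFreeMonoid.symm.surjective f
  rw [map_eq_zero_iff _ (AlgEquiv.injective _)]
  simp only [FreeAlgebra.lift_equivMonoidAlgebraFreeMonoid_symm, list_prod_map_single] at hf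
  ext w₀
  set l := w₀.toList.length with hl
  -- Only words of length `l` contribute in degree `g ^ l`. Each gives a multiplicative character of
  -- `ℕ → R`, and distinct characters are linearly independent.
  let χ : {w : FreeMonoid ℕ // w.toList.length = l} → ((ℕ → R) →* R) := fun w =>
    { toFun := fun r => ∏ j : Fin w.1.toList.length, g ^ (j : ℕ) • r (w.1.toList.get j)
      map_one' := by simp
      map_mul' := fun r s => by simp [Finset.prod_mul_distrib] }
  have hχ : Function.Injective χ := by
    rintro ⟨w, hw⟩ ⟨w', hw'⟩ h
    have key := eq_of_prod_pow_smul_eq (k := k) hu (l := l)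
      (w := fun j => w.toList.get (j.cast hw.symm)) (w' := fun j => w'.toList.get (j.cast hw'.symm))
      fun r => by
        refine Eq.trans ?_ ((DFunLike.congr_fun h r).trans ?_)
        · exact Fintype.prod_equiv (finCongr hw.symm) _ _ fun j => rfl
        · exact Fintype.prod_equiv (finCongr hw') _ _ fun j => rfl
    refine Subtype.ext (FreeMonoid.toList.injective (List.ext_get (hw.trans hw'.symm) ?_))
    intro n h₁ h₂
    exact congrFun key ⟨n, hw ▸ h₁⟩
  have hli := (linearIndependent_monoidHom (ℕ → R) R).comp χ hχ
  rw [linearIndependent_iff'] at hli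
  have := hli (F.coeff.support.subtype _) (fun w => algebraMap k R (F.coeff w.1)) ?_ ⟨w₀, rfl⟩
  · by_contra h
    exact h ((map_eq_zero _).1 (this (by simpa using h)))
  · funext r
    have h := congrArg (((Finsupp.applyAddHom (g ^ l)).comp (coeffAddEquiv (k := R)).toAddMonoidHom))
      (hf r)
    rw [Finsupp.sum, _root_.map_sum, map_zero] at h
    rw [Finset.sum_apply, Pi.zero_apply, ← h]
    refine Eq.trans ?_ (Finset.sum_subset (Finset.filter_subset (fun w => w.toList.length = l) _) ?_)
    · rw [← Finset.sum_subtype_eq_sum_filter]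
      refine Finset.sum_congr rfl fun w _ => ?_
      change algebraMap k R _ * χ w r =
        (F.coeff w.1 • single (g ^ w.1.toList.length) (χ w r)).coeff (g ^ l)
      rw [w.2, coeff_smul, coeff_single, Finsupp.smul_apply, Finsupp.single_eq_same,
        Algebra.smul_def]
    · intro w hw hwl
      change (F.coeff w • single (g ^ w.toList.length) _ : SkewMonoidAlgebra R G).coeff (g ^ l) = 0
      rw [coeff_smul, coeff_single, Finsupp.smul_apply, Finsupp.single_eq_of_ne, smul_zero]
      intro h
      exact hwl (Finset.mem_filter.2 ⟨hw, (hg h).symm⟩)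

end SkewMonoidAlgebra

/-! ### The subring `k[u, v]` and its twist by the generators. -/

namespace DownUpAlgebra

variable {k : Type*} [Field k] (α : k) {β : k} (hβ : β ≠ 0)

/-- The polynomial ring `k[u, v]`, to be mapped to `A(α, β)` by `u ↦ xy` and `v ↦ yx`. It carries
the action of `ℤ` generated by `u ↦ αu + βv`, `v ↦ u`. -/
def Coeff (_ : k) {β : k} (_ : β ≠ 0) : Type _ := MvPolynomial (Fin 2) k

namespace Coeff

noncomputable instance : CommRing (Coeff α hβ) := inferInstanceAs (CommRing (MvPolynomial _ k))
instance : IsDomain (Coeff α hβ) := inferInstanceAs (IsDomain (MvPolynomial _ k))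
noncomputable instance : Algebra k (Coeff α hβ) := inferInstanceAs (Algebra k (MvPolynomial _ k))

/-- The variable `u` of `k[u, v]`. -/
noncomputable def u : Coeff α hβ := (MvPolynomial.X 0 : MvPolynomial (Fin 2) k)

/-- The variable `v` of `k[u, v]`. -/
noncomputable def v : Coeff α hβ := (MvPolynomial.X 1 : MvPolynomial (Fin 2) k)

variable {α hβ} in
theorem algHom_ext {B : Type*} [Semiring B] [Algebra k B] {f g : Coeff α hβ →ₐ[k] B}
    (hu : f (u α hβ) = g (u α hβ)) (hv : f (v α hβ) = g (v α hβ)) : f = g :=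
  MvPolynomial.algHom_ext (Fin.forall_fin_two.2 ⟨hu, hv⟩)

theorem v_ne_zero : v α hβ ≠ 0 := MvPolynomial.X_ne_zero _

variable {α hβ} in
theorem exists_eq_algebraMap_of_isUnit {p : Coeff α hβ} (hp : IsUnit p) :
    ∃ c : k, p = algebraMap k _ c := by
  obtain ⟨c, -, hc⟩ := (MvPolynomial.isUnit_iff_eq_C_of_isReduced
    (P := (p : MvPolynomial (Fin 2) k))).1 hp
  exact ⟨c, hc⟩

variable {α hβ} in
theorem induction {motive : Coeff α hβ → Prop} (hC : ∀ c : k, motive (algebraMap k _ c))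
    (hu : motive (u α hβ)) (hv : motive (v α hβ)) (hadd : ∀ p q, motive p → motive q → motive (p + q))
    (hmul : ∀ p q, motive p → motive q → motive (p * q)) (p : Coeff α hβ) : motive p :=
  MvPolynomial.induction_on (motive := motive) p hC hadd fun p i hp =>
    hmul p _ hp (Fin.forall_fin_two (p := fun i => motive (MvPolynomial.X i : MvPolynomial _ k)).2
      ⟨hu, hv⟩ i)

section Lift

variable {B : Type*} [Ring B] [Algebra k B] {a b : B} (hab : Commute a b)

theorem _root_.Commute.isMulCommutative_adjoin_pair (k : Type*) [Field k] {B : Type*} [Ring B]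
    [Algebra k B] {a b : B} (hab : Commute a b) :
    IsMulCommutative (Algebra.adjoin k {a, b}) :=
  Algebra.isMulCommutative_adjoin k (by
    rintro _ (rfl | rfl) _ (rfl | rfl)
    exacts [rfl, hab, hab.symm, rfl])

open scoped IsMulCommutative in
/-- Evaluation of polynomials in two variables at two commuting elements of an algebra. -/
noncomputable def lift : Coeff α hβ →ₐ[k] B :=
  haveI := hab.isMulCommutative_adjoin_pair k
  (Algebra.adjoin k {a, b}).val.comp (MvPolynomial.aeval
    ![(⟨a, Algebra.subset_adjoin (by simp)⟩ : Algebra.adjoin k {a, b}),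
      ⟨b, Algebra.subset_adjoin (by simp)⟩] :
      MvPolynomial (Fin 2) k →ₐ[k] Algebra.adjoin k {a, b})

open scoped IsMulCommutative in
@[simp] theorem lift_u : lift α hβ hab (u α hβ) = a :=
  haveI := hab.isMulCommutative_adjoin_pair k
  congrArg Subtype.val (MvPolynomial.aeval_X _ _)

open scoped IsMulCommutative in
@[simp] theorem lift_v : lift α hβ hab (v α hβ) = b :=
  haveI := hab.isMulCommutative_adjoin_pair k
  congrArg Subtype.val (MvPolynomial.aeval_X _ _)

end Lift

/-- The automorphism `u ↦ αu + βv`, `v ↦ u` of `k[u, v]`. -/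
noncomputable def shift : Coeff α hβ ≃ₐ[k] Coeff α hβ :=
  AlgEquiv.ofAlgHom
    (lift α hβ (Commute.all (α • u α hβ + β • v α hβ) (u α hβ)))
    (lift α hβ (Commute.all (v α hβ) (β⁻¹ • (u α hβ - α • v α hβ))))
    (algHom_ext (by simp) (by simp [smul_smul, hβ]))
    (algHom_ext (by simp [smul_smul, hβ]) (by simp))

@[simp] theorem shift_u : shift α hβ (u α hβ) = α • u α hβ + β • v α hβ :=
  lift_u _ _ (Commute.all _ _)

@[simp] theorem shift_v : shift α hβ (v α hβ) = u α hβ := lift_v _ _ (Commute.all _ _)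

noncomputable instance : MulSemiringAction (Multiplicative ℤ) (Coeff α hβ) :=
  MulSemiringAction.compHom _ (zpowersHom (Coeff α hβ ≃ₐ[k] Coeff α hβ) (shift α hβ))

variable {α hβ} in
theorem ofAdd_smul (n : ℤ) (p : Coeff α hβ) :
    Multiplicative.ofAdd n • p = (shift α hβ ^ n) p := rfl

variable {α hβ} in
theorem ofAdd_one_smul (p : Coeff α hβ) : Multiplicative.ofAdd (1 : ℤ) • p = shift α hβ p := by
  rw [ofAdd_smul, zpow_one]

instance : SMulCommClass (Multiplicative ℤ) k (Coeff α hβ) where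
  smul_comm n c p := map_smul (shift α hβ ^ n.toAdd) c p

end Coeff

open Coeff

theorem relation_xxy : x α β ^ 2 * y α β =
    α • (x α β * y α β * x α β) + β • (y α β * x α β ^ 2) := by
  have := RingQuot.mkAlgHom_rel k (Rel.xxy (α := α) (β := β))
  simp only [map_sub, map_mul, map_smul, map_pow, map_zero] at this
  rwa [sub_sub, sub_eq_zero] at this

theorem relation_xyy : x α β * y α β ^ 2 =
    α • (y α β * x α β * y α β) + β • (y α β ^ 2 * x α β) := by
  have := RingQuot.mkAlgHom_rel k (Rel.xyy (α := α) (β := β))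
  simp only [map_sub, map_mul, map_smul, map_pow, map_zero] at this
  rwa [sub_sub, sub_eq_zero] at this

/-- The two relations rewrite both `xy²x` and `yx²y` as `α yxyx + β y²x²`. -/
theorem commute_xy_yx : Commute (x α β * y α β) (y α β * x α β) := by
  have h : x α β * y α β ^ 2 * x α β = y α β * (x α β ^ 2 * y α β) := by
    rw [relation_xxy, relation_xyy]
    simp only [add_mul, mul_add, smul_mul_assoc, mul_smul_comm, sq, mul_assoc]
  simpa only [Commute, SemiconjBy, sq, mul_assoc] using h

theorem adjoin_x_y : Algebra.adjoin k {x α β, y α β} = ⊤ := by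
  have h := congrArg (Subalgebra.map (RingQuot.mkAlgHom k (Rel α β)))
    (FreeAlgebra.adjoin_range_ι k (Fin 2))
  rw [AlgHom.map_adjoin, Algebra.map_top,
    (AlgHom.range_eq_top _).2 (RingQuot.mkAlgHom_surjective k (Rel α β))] at h
  refine Eq.trans (congrArg _ ?_) h
  rw [← Set.range_comp]
  ext z
  refine Iff.trans ?_ (Set.mem_range.trans Fin.exists_fin_two).symm
  exact or_congr eq_comm eq_comm

/-- The embedding of `k[u, v]` into `A(α, β)` given by `u ↦ xy`, `v ↦ yx`. -/
noncomputable def ofCoeff : Coeff α hβ →ₐ[k] DownUpAlgebra α β :=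
  Coeff.lift α hβ (commute_xy_yx α)

@[simp] theorem ofCoeff_u : ofCoeff α hβ (u α hβ) = x α β * y α β := lift_u ..

@[simp] theorem ofCoeff_v : ofCoeff α hβ (v α hβ) = y α β * x α β := lift_v ..

/-- On `u` this is the relation for `x²y`; on `v` it is associativity. -/
theorem x_mul_ofCoeff (p : Coeff α hβ) :
    x α β * ofCoeff α hβ p = ofCoeff α hβ (shift α hβ p) * x α β := by
  induction p using Coeff.induction with
  | hC c => simp [Algebra.commutes]
  | hu =>
    have := relation_xxy α (β := β)
    simp only [ofCoeff_u, ofCoeff_v, shift_u, map_add, map_smul]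
    simpa only [sq, add_mul, smul_mul_assoc, mul_assoc] using this
  | hv => simp [mul_assoc]
  | hadd p q hp hq => simp [mul_add, add_mul, hp, hq]
  | hmul p q hp hq => rw [map_mul, ← mul_assoc, hp, mul_assoc, hq, map_mul, map_mul, mul_assoc]

theorem ofCoeff_mul_y (p : Coeff α hβ) :
    ofCoeff α hβ p * y α β = y α β * ofCoeff α hβ (shift α hβ p) := by
  induction p using Coeff.induction with
  | hC c => simp [Algebra.commutes]
  | hu =>
    have := relation_xyy α (β := β)
    simp only [ofCoeff_u, ofCoeff_v, shift_u, map_add, map_smul]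
    simpa only [sq, mul_add, mul_smul_comm, mul_assoc] using this
  | hv => simp [mul_assoc]
  | hadd p q hp hq => simp [mul_add, add_mul, hp, hq]
  | hmul p q hp hq => rw [map_mul, mul_assoc, hq, ← mul_assoc, hp, map_mul, map_mul, mul_assoc]

theorem x_pow_mul_ofCoeff (n : ℕ) (p : Coeff α hβ) :
    x α β ^ n * ofCoeff α hβ p = ofCoeff α hβ ((shift α hβ ^ n) p) * x α β ^ n := by
  induction n generalizing p with
  | zero => simp
  | succ n ih =>
    rw [pow_succ, mul_assoc, x_mul_ofCoeff, ← mul_assoc, ih, mul_assoc, pow_succ,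
      AlgEquiv.mul_apply]

theorem ofCoeff_mul_y_pow (n : ℕ) (p : Coeff α hβ) :
    ofCoeff α hβ p * y α β ^ n = y α β ^ n * ofCoeff α hβ ((shift α hβ ^ n) p) := by
  induction n generalizing p with
  | zero => simp
  | succ n ih =>
    rw [pow_succ', ← mul_assoc, ofCoeff_mul_y, mul_assoc, ih, mul_assoc, pow_succ,
      AlgEquiv.mul_apply]

/-! ### Realization in the skew Laurent ring. -/

section Lift

variable {α} {B : Type*} [Ring B] [Algebra k B] {a b : B}
  (h₁ : a ^ 2 * b = α • (a * b * a) + β • (b * a ^ 2))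
  (h₂ : a * b ^ 2 = α • (b * a * b) + β • (b ^ 2 * a))

/-- The universal property of `A(α, β)`. -/
def lift : DownUpAlgebra α β →ₐ[k] B :=
  RingQuot.liftAlgHom k ⟨FreeAlgebra.lift k ![a, b], fun p q h => by
    cases h with
    | xxy => simp [h₁]
    | xyy => simp [h₂]⟩

@[simp] theorem lift_x : lift h₁ h₂ (x α β) = a :=
  (RingQuot.liftAlgHom_mkAlgHom_apply k _ _ _).trans (by simp)

@[simp] theorem lift_y : lift h₁ h₂ (y α β) = b :=
  (RingQuot.liftAlgHom_mkAlgHom_apply k _ _ _).trans (by simp)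

end Lift

theorem ofAdd_neg_one_smul_u : Multiplicative.ofAdd (-1 : ℤ) • u α hβ = v α hβ := by
  rw [ofAdd_neg, inv_smul_eq_iff, ofAdd_one_smul, shift_v]

theorem shift_ofAdd_neg_one_smul (p : Coeff α hβ) :
    shift α hβ (Multiplicative.ofAdd (-1 : ℤ) • p) = p := by
  rw [← ofAdd_one_smul, smul_smul, ← ofAdd_add, add_neg_cancel, ofAdd_zero, one_smul]

theorem u_eq_ofAdd_neg_one_smul :
    α • v α hβ + β • Multiplicative.ofAdd (-1 : ℤ) • v α hβ = u α hβ := by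
  have : SMulCommClass k (Multiplicative ℤ) (Coeff α hβ) := SMulCommClass.symm ..
  refine smul_left_cancel (Multiplicative.ofAdd (1 : ℤ)) ?_
  rw [smul_add, smul_comm _ α, smul_comm _ β, smul_smul, ← ofAdd_add, add_neg_cancel, ofAdd_zero,
    one_smul, ofAdd_one_smul, ofAdd_one_smul, shift_u, shift_v]

/-- The realization of `A(α, β)` inside the skew Laurent polynomial ring over `k[u, v]` in the
variable `x`, where `y = x⁻¹u`. -/
noncomputable def toSkewLaurent :
    DownUpAlgebra α β →ₐ[k] SkewMonoidAlgebra (Coeff α hβ) (Multiplicative ℤ) :=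
  -- Coefficients stand on the left, so `x⁻¹u` is written `σ⁻¹(u) x⁻¹ = v x⁻¹`.
  lift (a := .single (.ofAdd 1) 1) (b := .single (.ofAdd (-1)) (v α hβ))
    (by
      simp only [sq, mul_assoc]
      simp only [SkewMonoidAlgebra.single_mul_single, SkewMonoidAlgebra.smul_single,
        ← ofAdd_add, ofAdd_one_smul, shift_u, shift_v, one_mul, mul_one, smul_one]
      norm_num [SkewMonoidAlgebra.single_add])
    (by
      simp only [sq, mul_assoc]
      simp only [SkewMonoidAlgebra.single_mul_single, SkewMonoidAlgebra.smul_single,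
        ← ofAdd_add, ofAdd_one_smul, map_mul, shift_v, one_mul, mul_one, smul_one,
        ofAdd_neg_one_smul_u, shift_ofAdd_neg_one_smul]
      norm_num only
      rw [← SkewMonoidAlgebra.single_add, ← mul_smul_comm, ← mul_smul_comm, ← mul_add,
        u_eq_ofAdd_neg_one_smul, mul_comm])

theorem toSkewLaurent_x : toSkewLaurent α hβ (x α β) = .single (.ofAdd 1) 1 := lift_x ..

theorem toSkewLaurent_y : toSkewLaurent α hβ (y α β) = .single (.ofAdd (-1)) (v α hβ) := lift_y ..

theorem toSkewLaurent_ofCoeff (p : Coeff α hβ) :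
    toSkewLaurent α hβ (ofCoeff α hβ p) = .single 1 p := by
  induction p using Coeff.induction with
  | hC c =>
    rw [AlgHom.commutes, AlgHom.commutes]
    rfl
  | hu =>
    rw [ofCoeff_u, map_mul, toSkewLaurent_x, toSkewLaurent_y, SkewMonoidAlgebra.single_mul_single,
      ofAdd_one_smul, shift_v, one_mul]
    rfl
  | hv =>
    rw [ofCoeff_v, map_mul, toSkewLaurent_x, toSkewLaurent_y, SkewMonoidAlgebra.single_mul_single,
      smul_one, mul_one]
    rfl
  | hadd p q hp hq => rw [map_add, map_add, hp, hq, SkewMonoidAlgebra.single_add]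
  | hmul p q hp hq =>
    rw [map_mul, map_mul, hp, hq, SkewMonoidAlgebra.single_mul_single, one_smul, one_mul]

end DownUpAlgebra

namespace SkewMonoidAlgebra

theorem single_pow {R G : Type*} [CommRing R] [Group G] [MulSemiringAction G R] (a : G) (r : R)
    (n : ℕ) : (single a r) ^ n = single (a ^ n) (∏ j ∈ Finset.range n, a ^ j • r) := by
  induction n with
  | zero => simp
  | succ n ih => rw [pow_succ, ih, single_mul_single, Finset.prod_range_succ, pow_succ]

end SkewMonoidAlgebra

/-! ### Homogeneous decomposition over `k[u, v]` and roots of powers of generators. -/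

namespace DownUpAlgebra

open Coeff

variable {k : Type*} [Field k] (α : k) {β : k} (hβ : β ≠ 0)

variable (β) in
/-- The homogeneous basis of `A(α, β)` over `k[u, v]`: nonnegative powers of `x` and positive
powers of `y`. -/
def basisElement : ℤ → DownUpAlgebra α β
  | .ofNat n => x α β ^ n
  | .negSucc n => y α β ^ (n + 1)

theorem exists_toSkewLaurent_basisElement (i : ℤ) : ∃ N : Coeff α hβ, N ≠ 0 ∧
    toSkewLaurent α hβ (basisElement α β i) = .single (.ofAdd i) N := by
  cases i with
  | ofNat n =>
    refine ⟨_, ?_, by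
      rw [basisElement, map_pow, toSkewLaurent_x, SkewMonoidAlgebra.single_pow, ← ofAdd_nsmul,
        nsmul_one]; rfl⟩
    exact Finset.prod_ne_zero_iff.2 fun j _ => by simp
  | negSucc n =>
    refine ⟨_, ?_, by
      rw [basisElement, map_pow, toSkewLaurent_y, SkewMonoidAlgebra.single_pow, ← ofAdd_nsmul,
        nsmul_eq_mul, mul_neg_one]; rfl⟩
    exact Finset.prod_ne_zero_iff.2 fun j _ => (smul_ne_zero_iff_ne _).2 (v_ne_zero α hβ)

/-- The `k[u, v]`-linear combinations of the elements `basisElement α β i`. -/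
noncomputable def combination : (ℤ →₀ Coeff α hβ) →ₗ[k] DownUpAlgebra α β :=
  Finsupp.lsum k fun i => (LinearMap.mulRight k (basisElement α β i)).comp
    (ofCoeff α hβ).toLinearMap

@[simp] theorem combination_single (i : ℤ) (p : Coeff α hβ) :
    combination α hβ (.single i p) = ofCoeff α hβ p * basisElement α β i := by
  simp [combination]

/-- In negative degree, `y^(n+1) x = y^n v = σ^(-n)(v) y^n`. -/
theorem basisElement_mul_x (i : ℤ) : ∃ p : Coeff α hβ,
    basisElement α β i * x α β = ofCoeff α hβ p * basisElement α β (i + 1) := by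
  cases i with
  | ofNat n => exact ⟨1, by rw [map_one, one_mul]; exact (pow_succ _ _).symm⟩
  | negSucc n =>
    refine ⟨(shift α hβ ^ n).symm (v α hβ), ?_⟩
    have : basisElement α β (Int.negSucc n + 1) = y α β ^ n := by
      cases n with
      | zero => exact (pow_zero _).trans (pow_zero _).symm
      | succ n => rfl
    rw [this, ofCoeff_mul_y_pow, AlgEquiv.apply_symm_apply, ofCoeff_v, ← mul_assoc, ← pow_succ]
    rfl

theorem basisElement_mul_y (i : ℤ) : ∃ p : Coeff α hβ,
    basisElement α β i * y α β = ofCoeff α hβ p * basisElement α β (i - 1) := by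
  cases i with
  | ofNat n =>
    cases n with
    | zero => exact ⟨1, by
        rw [map_one, one_mul]
        exact (congrArg (· * _) (pow_zero _)).trans ((one_mul _).trans (pow_one _).symm)⟩
    | succ n =>
      refine ⟨(shift α hβ ^ n) (u α hβ), ?_⟩
      have : basisElement α β (Int.ofNat (n + 1) - 1) = x α β ^ n := by
        rw [show Int.ofNat (n + 1) - 1 = Int.ofNat n by simp]
        rfl
      rw [this, ← x_pow_mul_ofCoeff, ofCoeff_u, ← mul_assoc, ← pow_succ]
      rfl
  | negSucc n => exact ⟨1, by rw [map_one, one_mul]; exact (pow_succ _ _).symm⟩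

/-- The range contains `1` and is stable under right multiplication by `x` and `y`, which generate
the algebra. -/
theorem combination_surjective : Function.Surjective (combination α hβ) := by
  rw [← LinearMap.range_eq_top, eq_top_iff]
  have key : ∀ z : DownUpAlgebra α β, (∀ i, ∃ (p : Coeff α hβ) (j : ℤ),
      basisElement α β i * z = ofCoeff α hβ p * basisElement α β j) →
      ∀ w ∈ LinearMap.range (combination α hβ), w * z ∈ LinearMap.range (combination α hβ) := by
    rintro z hz _ ⟨m, rfl⟩
    induction m using Finsupp.induction_linear with
    | zero => simp
    | add m m' hm hm' => rw [map_add, add_mul]; exact add_mem hm hm'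
    | single i q =>
      obtain ⟨p, j, h⟩ := hz i
      rw [combination_single, mul_assoc, h, ← mul_assoc, ← map_mul, ← combination_single]
      exact LinearMap.mem_range_self _ _
  rintro a -
  have ha : a ∈ Algebra.adjoin k {x α β, y α β} := adjoin_x_y α (β := β) ▸ Algebra.mem_top
  suffices ∀ w ∈ LinearMap.range (combination α hβ), w * a ∈ LinearMap.range (combination α hβ) by
    have h := this 1 ⟨.single 0 1, by
      rw [combination_single, map_one, one_mul]; exact pow_zero _⟩
    rwa [one_mul] at h
  induction ha using Algebra.adjoin_induction with
  | mem z hz =>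
    rcases hz with rfl | rfl
    · exact key _ fun i => (basisElement_mul_x α hβ i).imp fun p h => ⟨_, h⟩
    · exact key _ fun i => (basisElement_mul_y α hβ i).imp fun p h => ⟨_, h⟩
  | algebraMap c =>
    intro w hw
    rw [← Algebra.commutes, ← Algebra.smul_def]
    exact Submodule.smul_mem _ c hw
  | add z z' _ _ hz hz' => intro w hw; rw [mul_add]; exact add_mem (hz w hw) (hz' w hw)
  | mul z z' _ _ hz hz' => intro w hw; rw [← mul_assoc]; exact hz' _ (hz w hw)

/-- `N` does not depend on `m`, so cancelling it recovers each coefficient of a combination from its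
Laurent image. -/
theorem exists_coeff_toSkewLaurent_combination (i : ℤ) : ∃ N : Coeff α hβ, N ≠ 0 ∧
    toSkewLaurent α hβ (basisElement α β i) = .single (.ofAdd i) N ∧
    ∀ m, (toSkewLaurent α hβ (combination α hβ m)).coeff (.ofAdd i) = m i * N := by
  obtain ⟨N, hN, h⟩ := exists_toSkewLaurent_basisElement α hβ i
  refine ⟨N, hN, h, fun m => ?_⟩
  induction m using Finsupp.induction_linear with
  | zero => simp
  | add m m' hm hm' => simp [add_mul, hm, hm']
  | single j q =>
    rw [combination_single, map_mul, toSkewLaurent_ofCoeff]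
    by_cases hij : j = i
    · subst hij
      rw [h, SkewMonoidAlgebra.single_mul_single]
      simp
    · obtain ⟨N', -, h'⟩ := exists_toSkewLaurent_basisElement α hβ j
      rw [h', SkewMonoidAlgebra.single_mul_single, SkewMonoidAlgebra.coeff_single, one_mul,
        Finsupp.single_eq_of_ne (Ne.symm hij), zero_mul,
        Finsupp.single_eq_of_ne (fun e => hij (Multiplicative.ofAdd.injective e.symm))]

theorem toSkewLaurent_combination_injective :
    Function.Injective fun m => toSkewLaurent α hβ (combination α hβ m) := by
  intro m m' h
  ext i
  obtain ⟨N, hN, -, hm⟩ := exists_coeff_toSkewLaurent_combination α hβ i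
  exact mul_right_cancel₀ hN ((hm m).symm.trans
    ((congrArg (fun z => z.coeff (.ofAdd i)) h).trans (hm m')))

/-- In `A(α, β)`, the `n`-th roots of the `n`-th power of a power of `x` or `y` are its scalar
multiples. -/
theorem exists_eq_smul_of_pow_eq (hβ : β ≠ 0) {z : DownUpAlgebra α β} {i : ℤ} {n : ℕ} (hn : n ≠ 0)
    (h : z ^ n = basisElement α β i ^ n) : ∃ c : k, z = c • basisElement α β i := by
  obtain ⟨m, rfl⟩ := combination_surjective α hβ z
  obtain ⟨N, hN, hi, hm⟩ := exists_coeff_toSkewLaurent_combination α hβ i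
  have h' := congrArg (toSkewLaurent α hβ) h
  rw [map_pow, map_pow, hi, SkewMonoidAlgebra.single_pow] at h'
  have hz := SkewMonoidAlgebra.eq_single_of_pow_eq_single hn h'
  rw [hm] at hz
  rw [hz, SkewMonoidAlgebra.single_pow] at h'
  have hprod := SkewMonoidAlgebra.single_injective _ h'
  simp only [smul_mul', Finset.prod_mul_distrib] at hprod
  have hone := mul_left_eq_self₀.1 hprod |>.resolve_right
    (Finset.prod_ne_zero_iff.2 fun j _ => (smul_ne_zero_iff_ne _).2 hN)
  -- The factor at `j = 0` of a product equal to `1` is `m i` itself; this needs `n ≠ 0`.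
  have hunit : IsUnit (m i) := isUnit_of_dvd_one (hone ▸ by
    simpa using Finset.dvd_prod_of_mem (fun j => Multiplicative.ofAdd i ^ j • m i)
      (Finset.mem_range.2 (Nat.pos_of_ne_zero hn)))
  obtain ⟨c, hc⟩ := exists_eq_algebraMap_of_isUnit hunit
  have hm' : m = .single i (m i) := toSkewLaurent_combination_injective α hβ (by
    dsimp only
    rw [hz, combination_single, map_mul, toSkewLaurent_ofCoeff, hi,
      SkewMonoidAlgebra.single_mul_single, one_mul, one_smul])
  refine ⟨c, ?_⟩
  rw [hm', combination_single, hc, AlgHom.commutes, Algebra.smul_def]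

theorem mem_center_of_commute {z : DownUpAlgebra α β} (hx : Commute z (x α β))
    (hy : Commute z (y α β)) : z ∈ Subalgebra.center k (DownUpAlgebra α β) := by
  rw [Subalgebra.mem_center_iff]
  intro a
  have ha : a ∈ Algebra.adjoin k {x α β, y α β} := adjoin_x_y α (β := β) ▸ Algebra.mem_top
  induction ha using Algebra.adjoin_induction with
  | mem a ha =>
    rcases ha with rfl | rfl
    exacts [hx.symm, hy.symm]
  | algebraMap c => exact Algebra.commutes _ _
  | add a b _ _ ha hb => exact Commute.add_left ha hb
  | mul a b _ _ ha hb => exact Commute.mul_left ha hb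

/-! ### Finite orbits, central powers and polynomial identities. -/

section FiniteOrder

variable {α hβ} {n : ℕ} (hu : (shift α hβ ^ (n + 1)) (u α hβ) = u α hβ)
include hu

theorem shift_pow_u_of_shift_pow_succ_u : (shift α hβ ^ n) (u α hβ) = v α hβ := by
  apply (shift α hβ).injective
  rw [shift_v, ← AlgEquiv.mul_apply, ← pow_succ', hu]

/-- `x^(n+1) y = x^n u = σ^n(u) x^n = v x^n = y x^(n+1)`. -/
theorem x_pow_mem_center : x α β ^ (n + 1) ∈ Subalgebra.center k (DownUpAlgebra α β) := by
  refine mem_center_of_commute α ((Commute.refl _).pow_left _) ?_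
  rw [Commute, SemiconjBy, pow_succ, mul_assoc, ← ofCoeff_u α hβ, x_pow_mul_ofCoeff,
    shift_pow_u_of_shift_pow_succ_u hu, ofCoeff_v, mul_assoc, ← pow_succ', pow_succ]

theorem y_pow_mem_center : y α β ^ (n + 1) ∈ Subalgebra.center k (DownUpAlgebra α β) := by
  refine mem_center_of_commute α ?_ ((Commute.refl _).pow_left _)
  refine Commute.symm ?_
  rw [Commute, SemiconjBy, pow_succ', ← mul_assoc, ← ofCoeff_u α hβ, ofCoeff_mul_y_pow,
    shift_pow_u_of_shift_pow_succ_u hu, ofCoeff_v, ← mul_assoc, ← pow_succ, ← pow_succ']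

end FiniteOrder

/-- If `A(α, β)` is PI, then the orbit of `u = xy` under the automorphism of `k[u, v]` is finite. -/
theorem exists_shift_pow_u_eq [Infinite k] (hPI : IsPIAlgebra k (DownUpAlgebra α β)) :
    ∃ n : ℕ, (shift α hβ ^ (n + 1)) (u α hβ) = u α hβ := by
  by_contra! hne
  obtain ⟨f, hf, hfv⟩ := hPI
  refine hf (SkewMonoidAlgebra.eq_zero_of_forall_lift_single_eq_zero
    (g := Multiplicative.ofAdd (1 : ℤ)) (u := u α hβ) ?_ ?_ f fun r => ?_)
  · intro i j h
    simpa [← ofAdd_nsmul] using h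
  · have hlt : ∀ i j : ℕ, i < j → (Multiplicative.ofAdd (1 : ℤ)) ^ i • u α hβ ≠
        (Multiplicative.ofAdd (1 : ℤ)) ^ j • u α hβ := by
      intro i j hij h
      obtain ⟨d, rfl⟩ := Nat.exists_eq_add_of_lt hij
      rw [add_assoc, pow_add, mul_smul, smul_left_cancel_iff, ← ofAdd_nsmul, nsmul_one, Coeff.ofAdd_smul,
        zpow_natCast] at h
      exact hne d h.symm
    intro i j h
    by_contra hij
    rcases lt_or_gt_of_ne hij with hij | hij
    exacts [hlt i j hij h, hlt j i hij h.symm]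
  · have h := congrArg (toSkewLaurent α hβ) (hfv fun i => ofCoeff α hβ (r i) * x α β)
    rw [map_zero, ← AlgHom.comp_apply] at h
    rw [← h]
    refine DFunLike.congr_fun (FreeAlgebra.hom_ext (funext fun i => ?_)) f
    simp [toSkewLaurent_ofCoeff, toSkewLaurent_x, SkewMonoidAlgebra.single_mul_single]

theorem algEquiv_ext {φ ψ : DownUpAlgebra α β ≃ₐ[k] DownUpAlgebra α β}
    (hx : φ (x α β) = ψ (x α β)) (hy : φ (y α β) = ψ (y α β)) : φ = ψ := by
  refine AlgEquiv.coe_toAlgHom_injective (AlgHom.ext_of_adjoin_eq_top (adjoin_x_y α) ?_)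
  rintro _ (rfl | rfl)
  exacts [hx, hy]

end DownUpAlgebra

/-! ### Ozone automorphisms are diagonal. -/

theorem corollary4p7 {k : Type*} [Field k] [CharZero k] (α β : k) (hβ : β ≠ 0)
    (hPI : IsPIAlgebra k (DownUpAlgebra α β)) :
    (∀ φ ∈ ozoneGroup k (DownUpAlgebra α β),
      φ (DownUpAlgebra.x α β) ∈ Submodule.span k {DownUpAlgebra.x α β} ∧
      φ (DownUpAlgebra.y α β) ∈ Submodule.span k {DownUpAlgebra.y α β}) ∧
    (∀ φ ∈ ozoneGroup k (DownUpAlgebra α β), ∀ ψ ∈ ozoneGroup k (DownUpAlgebra α β),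
      φ * ψ = ψ * φ) := by
  have key : ∀ φ ∈ ozoneGroup k (DownUpAlgebra α β),
      φ (DownUpAlgebra.x α β) ∈ Submodule.span k {DownUpAlgebra.x α β} ∧
      φ (DownUpAlgebra.y α β) ∈ Submodule.span k {DownUpAlgebra.y α β} := by
    intro φ hφ
    obtain ⟨n, hn⟩ := DownUpAlgebra.exists_shift_pow_u_eq α hβ hPI
    have hx := hφ _ (DownUpAlgebra.x_pow_mem_center hn)
    have hy := hφ _ (DownUpAlgebra.y_pow_mem_center hn)
    rw [map_pow] at hx hy
    have ex : DownUpAlgebra.basisElement α β 1 = DownUpAlgebra.x α β := pow_one _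
    have ey : DownUpAlgebra.basisElement α β (-1) = DownUpAlgebra.y α β := pow_one _
    rw [Submodule.mem_span_singleton, Submodule.mem_span_singleton]
    obtain ⟨c, hc⟩ := DownUpAlgebra.exists_eq_smul_of_pow_eq α hβ n.succ_ne_zero
      (hx.trans (congrArg (· ^ (n + 1)) ex.symm))
    obtain ⟨d, hd⟩ := DownUpAlgebra.exists_eq_smul_of_pow_eq α hβ n.succ_ne_zero
      (hy.trans (congrArg (· ^ (n + 1)) ey.symm))
    exact ⟨⟨c, by rw [hc, ex]⟩, ⟨d, by rw [hd, ey]⟩⟩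
  refine ⟨key, fun φ hφ ψ hψ => ?_⟩
  obtain ⟨hφx, hφy⟩ := key φ hφ
  obtain ⟨hψx, hψy⟩ := key ψ hψ
  rw [Submodule.mem_span_singleton] at hφx hφy hψx hψy
  obtain ⟨a, ha⟩ := hφx
  obtain ⟨b, hb⟩ := hφy
  obtain ⟨c, hc⟩ := hψx
  obtain ⟨d, hd⟩ := hψy
  apply DownUpAlgebra.algEquiv_ext
  · rw [AlgEquiv.mul_apply, AlgEquiv.mul_apply, ← ha, ← hc, map_smul, map_smul, ← ha, ← hc,
      smul_comm]
  · rw [AlgEquiv.mul_apply, AlgEquiv.mul_apply, ← hb, ← hd, map_smul, map_smul, ← hb, ← hd,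
      smul_comm]
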